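/- Let $\mathbb F$ be a field of characteristic $0$ and let $\mathbb I=\{0,1,2,3\}$. The tetrahedron algebra $\boxtimes$ is the Lie algebra over $\mathbb F$ with generators $x_{i,j}$ ($i,j\in\mathbb I$, $i\ne j$) and relations - $x_{i,j}+x_{j,i}=0$ for distinct $i,j$; - $[x_{i,j},x_{j,k}]=2x_{i,j}+2x_{j,k}$ for mutually distinct $i,j,k$; - $[x_{i,j},[x_{i,j},[x_{i,j},x_{k,\ell}]]]=4[x_{i,j},x_{k,\ell}]$ for mutually distinct $i,j,k,\ell$. Let $P(\mathbb I)$ be the set of the three partitions of $\mathbb I$ into two subsets with two elements each. For mutually distinct $i,j,k\in\mathbb I$, call $(i,j,k)$ even if the unique permutation $\tau$ of $\mathbb I$ with $\tau(0)=i$, $\tau(1)=j$, $\tau(2)=k$ is even. Let $\widehat\boxtimes$ be the Lie algebra over $\mathbb F$ with generators $X_{i,j}$ ($i,j\in\mathbb I$, $i\neq j$) and $C_p$ ($p\in P(\mathbb I)$) and relations - $C_p$ is central for every $p\in P(\mathbb I)$; - $\sum_{p\in P(\mathbb I)}C_p=0$; - $X_{i,j}+X_{j,i}=C_p$ for distinct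 $i,j$, where $p$ consists of $\{i,j\}$ and its complement in $\mathbb I$; - $[X_{i,j},X_{j,k}]=2X_{i,j}+2X_{j,k}$ for mutually distinct $i,j,k$ such that $(i,j,k)$ is even; - $[X_{i,j},[X_{i,j},[X_{i,j},X_{k,\ell}]]]=4[X_{i,j},X_{k,\ell}]$ for mutually distinct $i,j,k,\ell$. Let $\pi:\widehat\boxtimes\to\boxtimes$ be the homomorphism of Lie algebras with $\pi(X_{i,j})=x_{i,j}$ for distinct $i,j\in\mathbb I$ and $\pi(C_p)=0$ for $p\in P(\mathbb I)$. A central extension of a Lie algebra $\mathcal L$ over $\mathbb F$ is a pair $(\mathcal K,\pi)$ consisting of a Lie algebra $\mathcal K$ over $\mathbb F$ and a surjective Lie algebra homomorphism $\pi:\mathcal K\to\mathcal L$ whose kernel lies in the center of $\mathcal K$. It is universal if for every central extension $(\mathcal K',\pi')$ of $\mathcal L$ there is exactly one Lie algebra homomorphism $\varphi:\mathcal K\to\mathcal K'$ with $\pi=\pi'\circ\varphi$. Then $(\widehat\boxtimes,\pi)$ is a universal central extension of $\boxtimes$. -/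

import Mathlib

universe v u

/-! ### Central extensions -/

/-- The pair `(K, π)` is a central extension of the Lie algebra `L`: the homomorphism `π` is
surjective and its kernel lies in the center of `K`. -/
def IsCentralExtension {F K L : Type*} [Field F] [LieRing K] [LieAlgebra F K]
    [LieRing L] [LieAlgebra F L] (π : K →ₗ⁅F⁆ L) : Prop :=
  Function.Surjective π ∧ π.ker ≤ LieAlgebra.center F K

/-- The pair `(K, π)` is a universal central extension of `L`: it is a central extension, and for
every central extension `(K', π')` of `L` there is exactly one homomorphism of Lie algebras
`φ : K → K'` with `π = π' ∘ φ`.  Here `K'` ranges over an arbitrary universe `w`. -/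
def IsUniversalCentralExtension.{w, u₁, u₂, u₃} {F : Type u₁} {K : Type u₂} {L : Type u₃} [Field F]
    [LieRing K] [LieAlgebra F K] [LieRing L] [LieAlgebra F L] (π : K →ₗ⁅F⁆ L) : Prop :=
  IsCentralExtension π ∧
    ∀ (K' : Type w) [LieRing K'] [LieAlgebra F K'] (π' : K' →ₗ⁅F⁆ L), IsCentralExtension π' →
      ∃! φ : K →ₗ⁅F⁆ K', π'.comp φ = π

/-! ### Lie algebras given by generators and relations -/

/-- The Lie algebra over `F` with generators `X` and relations `r = 0` for `r ∈ rels`. -/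
abbrev PresentedLieAlgebra (F : Type*) [Field F] {X : Type*} (rels : Set (FreeLieAlgebra F X)) :
    Type _ :=
  FreeLieAlgebra F X ⧸
    (LieSubmodule.lieSpan F (FreeLieAlgebra F X) rels : LieIdeal F (FreeLieAlgebra F X))

namespace PresentedLieAlgebra

/-- The image of a generator. -/
noncomputable def of (F : Type*) [Field F] {X : Type*} (rels : Set (FreeLieAlgebra F X)) (x : X) :
    PresentedLieAlgebra F rels :=
  LieSubmodule.Quotient.mk (FreeLieAlgebra.of F x)

/-- The homomorphism out of a presented Lie algebra determined by images of the generators that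
satisfy the relations. -/
noncomputable def lift {F : Type*} [Field F] {X : Type*} {rels : Set (FreeLieAlgebra F X)}
    {L : Type*} [LieRing L] [LieAlgebra F L] (f : X → L)
    (hf : ∀ r ∈ rels, FreeLieAlgebra.lift F f r = 0) :
    PresentedLieAlgebra F rels →ₗ⁅F⁆ L :=
  { Submodule.liftQ
      (LieSubmodule.lieSpan F (FreeLieAlgebra F X) rels : LieIdeal F (FreeLieAlgebra F X)).toSubmodule
      (FreeLieAlgebra.lift F f : FreeLieAlgebra F X →ₗ[F] L)
      (by
        intro r hr
        have h : (LieSubmodule.lieSpan F (FreeLieAlgebra F X) rels :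
            LieIdeal F (FreeLieAlgebra F X)) ≤ (FreeLieAlgebra.lift F f).ker :=
          LieSubmodule.lieSpan_le.2 fun r hr => (LieHom.mem_ker).2 (hf r hr)
        exact (LieHom.mem_ker).1 (h hr)) with
    map_lie' := by
      intro x y
      obtain ⟨a, rfl⟩ := LieSubmodule.Quotient.surjective_mk' _ x
      obtain ⟨b, rfl⟩ := LieSubmodule.Quotient.surjective_mk' _ y
      exact LieHom.map_lie (FreeLieAlgebra.lift F f) a b }

theorem lift_mk {F : Type*} [Field F] {X : Type*} {rels : Set (FreeLieAlgebra F X)}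
    {L : Type*} [LieRing L] [LieAlgebra F L] (f : X → L)
    (hf : ∀ r ∈ rels, FreeLieAlgebra.lift F f r = 0) (a : FreeLieAlgebra F X) :
    lift f hf (LieSubmodule.Quotient.mk a) = FreeLieAlgebra.lift F f a :=
  rfl

theorem lift_of {F : Type*} [Field F] {X : Type*} {rels : Set (FreeLieAlgebra F X)}
    {L : Type*} [LieRing L] [LieAlgebra F L] (f : X → L)
    (hf : ∀ r ∈ rels, FreeLieAlgebra.lift F f r = 0) (x : X) :
    lift f hf (of F rels x) = f x :=
  FreeLieAlgebra.lift_of_apply f x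

theorem mk_eq_zero_of_mem {F : Type*} [Field F] {X : Type*} {rels : Set (FreeLieAlgebra F X)}
    {r : FreeLieAlgebra F X} (hr : r ∈ rels) :
    (LieSubmodule.Quotient.mk r : PresentedLieAlgebra F rels) = 0 :=
  LieSubmodule.Quotient.mk_eq_zero'.2 (LieSubmodule.subset_lieSpan hr)

theorem lift_of_eq_mk {F : Type*} [Field F] {X : Type*} (rels : Set (FreeLieAlgebra F X))
    (a : FreeLieAlgebra F X) :
    FreeLieAlgebra.lift F (of F rels) a = LieSubmodule.Quotient.mk a := by
  have h : FreeLieAlgebra.lift F (of F rels) =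
      ({ (LieSubmodule.Quotient.mk' (LieSubmodule.lieSpan F (FreeLieAlgebra F X) rels :
          LieIdeal F (FreeLieAlgebra F X)) : FreeLieAlgebra F X →ₗ[F] _) with
        map_lie' := fun {x y} => LieSubmodule.Quotient.mk_bracket _ x y } :
        FreeLieAlgebra F X →ₗ⁅F⁆ PresentedLieAlgebra F rels) :=
    FreeLieAlgebra.hom_ext fun x => FreeLieAlgebra.lift_of_apply _ x
  rw [h]
  rfl

end PresentedLieAlgebra

/-! ### The tetrahedron algebra -/

/-- The index set of the generators `x_{i,j}`, with `i, j ∈ {0,1,2,3}` distinct. -/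
inductive TetGen : Type
  | x (i j : Fin 4) (h : i ≠ j) : TetGen

/-- The relators (left-hand side minus right-hand side of a defining relation) of the tetrahedron
algebra. -/
inductive TetRel (F : Type*) [Field F] : FreeLieAlgebra F TetGen → Prop
  | skew (i j : Fin 4) (hij : i ≠ j) :
      TetRel F (FreeLieAlgebra.of F (TetGen.x i j hij) + FreeLieAlgebra.of F (TetGen.x j i hij.symm))
  | triple (i j k : Fin 4) (hij : i ≠ j) (hjk : j ≠ k) (hik : i ≠ k) :
      TetRel F
        (⁅FreeLieAlgebra.of F (TetGen.x i j hij), FreeLieAlgebra.of F (TetGen.x j k hjk)⁆ -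
          ((2 : F) • FreeLieAlgebra.of F (TetGen.x i j hij) +
            (2 : F) • FreeLieAlgebra.of F (TetGen.x j k hjk)))
  | dolanGrady (i j k l : Fin 4) (hij : i ≠ j) (hik : i ≠ k) (hil : i ≠ l) (hjk : j ≠ k)
      (hjl : j ≠ l) (hkl : k ≠ l) :
      TetRel F
        (⁅FreeLieAlgebra.of F (TetGen.x i j hij),
          ⁅FreeLieAlgebra.of F (TetGen.x i j hij),
            ⁅FreeLieAlgebra.of F (TetGen.x i j hij), FreeLieAlgebra.of F (TetGen.x k l hkl)⁆⁆⁆ -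
          (4 : F) •
            ⁅FreeLieAlgebra.of F (TetGen.x i j hij), FreeLieAlgebra.of F (TetGen.x k l hkl)⁆)

/-- The tetrahedron algebra `⊠` over `F`. -/
abbrev Tetrahedron (F : Type*) [Field F] : Type _ :=
  PresentedLieAlgebra F {r | TetRel F r}

namespace Tetrahedron

/-- The generator `x_{i,j}` of `⊠`. -/
noncomputable def x (F : Type*) [Field F] (i j : Fin 4) (h : i ≠ j) : Tetrahedron F :=
  PresentedLieAlgebra.of F {r | TetRel F r} (TetGen.x i j h)

end Tetrahedron

/-! ### The Lie algebra `⊠̂` -/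

/-- The partitions of `{0,1,2,3}` into two subsets with two elements each. -/
@[ext]
structure PairPartition : Type where
  toFinpartition : Finpartition (Finset.univ : Finset (Fin 4))
  card_eq_two : ∀ s ∈ toFinpartition.parts, s.card = 2

instance : Finite PairPartition :=
  Finite.of_injective PairPartition.toFinpartition fun _ _ h => PairPartition.ext h

noncomputable instance : Fintype PairPartition :=
  Fintype.ofFinite PairPartition

/-- The sequence `(i,j,k)` is even: the permutation `τ` of `{0,1,2,3}` with `τ 0 = i`, `τ 1 = j`,
`τ 2 = k` exists and is even.  In particular `i, j, k` are mutually distinct. -/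
def EvenTriple (i j k : Fin 4) : Prop :=
  ∃ τ : Equiv.Perm (Fin 4), τ ∈ alternatingGroup (Fin 4) ∧ τ 0 = i ∧ τ 1 = j ∧ τ 2 = k

/-- The index set of the generators `X_{i,j}` (`i, j` distinct) and `C_p` of `⊠̂`. -/
inductive HatTetGen : Type
  | X (i j : Fin 4) (h : i ≠ j) : HatTetGen
  | C (p : PairPartition) : HatTetGen

/-- The relators (left-hand side minus right-hand side of a defining relation) of `⊠̂`. -/
inductive HatTetRel (F : Type*) [Field F] : FreeLieAlgebra F HatTetGen → Prop
  | central (p : PairPartition) (a : FreeLieAlgebra F HatTetGen) :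
      HatTetRel F ⁅FreeLieAlgebra.of F (HatTetGen.C p), a⁆
  | sum : HatTetRel F (∑ p : PairPartition, FreeLieAlgebra.of F (HatTetGen.C p))
  | skew (i j : Fin 4) (hij : i ≠ j) (p : PairPartition) (hp : {i, j} ∈ p.toFinpartition.parts) :
      HatTetRel F
        (FreeLieAlgebra.of F (HatTetGen.X i j hij) + FreeLieAlgebra.of F (HatTetGen.X j i hij.symm) -
          FreeLieAlgebra.of F (HatTetGen.C p))
  | triple (i j k : Fin 4) (hij : i ≠ j) (hjk : j ≠ k) (hik : i ≠ k) (he : EvenTriple i j k) :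
      HatTetRel F
        (⁅FreeLieAlgebra.of F (HatTetGen.X i j hij), FreeLieAlgebra.of F (HatTetGen.X j k hjk)⁆ -
          ((2 : F) • FreeLieAlgebra.of F (HatTetGen.X i j hij) +
            (2 : F) • FreeLieAlgebra.of F (HatTetGen.X j k hjk)))
  | dolanGrady (i j k l : Fin 4) (hij : i ≠ j) (hik : i ≠ k) (hil : i ≠ l) (hjk : j ≠ k)
      (hjl : j ≠ l) (hkl : k ≠ l) :
      HatTetRel F
        (⁅FreeLieAlgebra.of F (HatTetGen.X i j hij),
          ⁅FreeLieAlgebra.of F (HatTetGen.X i j hij),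
            ⁅FreeLieAlgebra.of F (HatTetGen.X i j hij), FreeLieAlgebra.of F (HatTetGen.X k l hkl)⁆⁆⁆ -
          (4 : F) •
            ⁅FreeLieAlgebra.of F (HatTetGen.X i j hij), FreeLieAlgebra.of F (HatTetGen.X k l hkl)⁆)

/-- The Lie algebra `⊠̂` over `F`. -/
abbrev HatTetrahedron (F : Type*) [Field F] : Type _ :=
  PresentedLieAlgebra F {r | HatTetRel F r}

namespace HatTetrahedron

/-- The generator `X_{i,j}` of `⊠̂`. -/
noncomputable def X (F : Type*) [Field F] (i j : Fin 4) (h : i ≠ j) : HatTetrahedron F :=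
  PresentedLieAlgebra.of F {r | HatTetRel F r} (HatTetGen.X i j h)

/-- The generator `C_p` of `⊠̂`. -/
noncomputable def C (F : Type*) [Field F] (p : PairPartition) : HatTetrahedron F :=
  PresentedLieAlgebra.of F {r | HatTetRel F r} (HatTetGen.C p)

/-- The images of the generators under `π`: `X_{i,j} ↦ x_{i,j}` and `C_p ↦ 0`. -/
noncomputable def projGen (F : Type*) [Field F] : HatTetGen → Tetrahedron F
  | HatTetGen.X i j h => Tetrahedron.x F i j h
  | HatTetGen.C _ => 0

theorem lift_projGen_eq_zero (F : Type*) [Field F] (r : FreeLieAlgebra F HatTetGen)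
    (hr : HatTetRel F r) : FreeLieAlgebra.lift F (projGen F) r = 0 := by
  have key : ∀ s : FreeLieAlgebra F TetGen, TetRel F s →
      FreeLieAlgebra.lift F (PresentedLieAlgebra.of F {r | TetRel F r}) s = 0 := fun s hs => by
    rw [PresentedLieAlgebra.lift_of_eq_mk]
    exact PresentedLieAlgebra.mk_eq_zero_of_mem hs
  cases hr with
  | central p a => simp [projGen]
  | sum => simp only [map_sum, FreeLieAlgebra.lift_of_apply, projGen, Finset.sum_const_zero]
  | skew i j hij p hp => simpa [projGen, Tetrahedron.x] using key _ (TetRel.skew i j hij)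
  | triple i j k hij hjk hik he =>
    simpa [projGen, Tetrahedron.x] using key _ (TetRel.triple i j k hij hjk hik)
  | dolanGrady i j k l hij hik hil hjk hjl hkl =>
    simpa [projGen, Tetrahedron.x] using key _ (TetRel.dolanGrady i j k l hij hik hil hjk hjl hkl)

/-- The homomorphism of Lie algebras `π : ⊠̂ → ⊠` with `π (X_{i,j}) = x_{i,j}` and `π (C_p) = 0`. -/
noncomputable def proj (F : Type*) [Field F] : HatTetrahedron F →ₗ⁅F⁆ Tetrahedron F :=
  PresentedLieAlgebra.lift (projGen F) (lift_projGen_eq_zero F)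

theorem proj_X (F : Type*) [Field F] (i j : Fin 4) (h : i ≠ j) :
    proj F (X F i j h) = Tetrahedron.x F i j h :=
  PresentedLieAlgebra.lift_of (projGen F) (lift_projGen_eq_zero F) (HatTetGen.X i j h)

theorem proj_C (F : Type*) [Field F] (p : PairPartition) : proj F (C F p) = 0 :=
  PresentedLieAlgebra.lift_of (projGen F) (lift_projGen_eq_zero F) (HatTetGen.C p)

end HatTetrahedron

/-! ### Presented Lie algebras -/

namespace PresentedLieAlgebra

variable {F : Type*} [Field F] {X : Type*} {rels : Set (FreeLieAlgebra F X)}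
  {L : Type*} [LieRing L] [LieAlgebra F L]

/-! In a central extension the bracket of two elements depends only on their images
(`IsCentralExtension.lie_congr`), and everything rests on this.

The kernel of `proj` is central because `⊠̂` modulo its center satisfies the relations of `⊠`: the
quotient map factors through `proj` (`ker_proj_le`). Uniqueness holds because every generator of
`⊠̂` is a combination of brackets, so `⊠̂` is perfect.

For existence, the same combination of brackets, applied to an arbitrary lift of the `x_{i,j}`,
gives lifts `z i j` satisfying the even triple relations exactly (`exists_normalized_lift`). The
elements `z i j + z j i` are central, and the Jacobi identity at each vertex makes the three
belonging to its edges sum to zero. The four vertex equations then force opposite edges to agree,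
leaving one value per pair partition, and these values sum to zero. The Dolan–Grady relation holds
up to a central defect, which a weight argument shows to vanish (`dolanGrady_of_weights`). -/

theorem surjective_mk :
    Function.Surjective
      (LieSubmodule.Quotient.mk : FreeLieAlgebra F X → PresentedLieAlgebra F rels) :=
  LieSubmodule.Quotient.surjective_mk' _

theorem lift_of_comp (φ : PresentedLieAlgebra F rels →ₗ⁅F⁆ L) (a : FreeLieAlgebra F X) :
    FreeLieAlgebra.lift F (fun x => φ (of F rels x)) a = φ (LieSubmodule.Quotient.mk a) := by
  have h : FreeLieAlgebra.lift F (fun x => φ (of F rels x)) =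
      φ.comp (FreeLieAlgebra.lift F (of F rels)) :=
    FreeLieAlgebra.hom_ext fun x => by simp
  rw [h, LieHom.comp_apply, lift_of_eq_mk]

theorem hom_ext {φ ψ : PresentedLieAlgebra F rels →ₗ⁅F⁆ L}
    (h : ∀ x, φ (of F rels x) = ψ (of F rels x)) : φ = ψ := by
  ext a
  obtain ⟨a, rfl⟩ := surjective_mk a
  rw [← lift_of_comp, ← lift_of_comp]
  simp only [h]

theorem mem_of_forall_of_mem (S : LieSubalgebra F (PresentedLieAlgebra F rels))
    (h : ∀ x, of F rels x ∈ S) (a : PresentedLieAlgebra F rels) : a ∈ S := by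
  obtain ⟨a, rfl⟩ := surjective_mk a
  have hc : S.incl.comp (FreeLieAlgebra.lift F (fun x => (⟨of F rels x, h x⟩ : S))) =
      FreeLieAlgebra.lift F (of F rels) :=
    FreeLieAlgebra.hom_ext fun x => by simp
  rw [← lift_of_eq_mk, ← hc]
  exact (FreeLieAlgebra.lift F (fun x => (⟨of F rels x, h x⟩ : S)) a).2

end PresentedLieAlgebra

/-! ### Brackets in a central extension -/

namespace IsCentralExtension

variable {F K L : Type*} [Field F] [LieRing K] [LieAlgebra F K] [LieRing L] [LieAlgebra F L]
  {π : K →ₗ⁅F⁆ L}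

theorem lie_eq_zero (hπ : IsCentralExtension π) {a : K} (ha : π a = 0) (b : K) : ⁅a, b⁆ = 0 := by
  have h := hπ.2 ((LieHom.mem_ker).2 ha)
  rw [← lie_skew, (LieModule.mem_maxTrivSubmodule F K K a).1 h b, neg_zero]

theorem lie_eq_zero' (hπ : IsCentralExtension π) {a : K} (ha : π a = 0) (b : K) : ⁅b, a⁆ = 0 := by
  rw [← lie_skew, hπ.lie_eq_zero ha, neg_zero]

/-- Two lifts of the same element differ by a central one, which brackets ignore. -/
theorem lie_congr (hπ : IsCentralExtension π) {a a' b b' : K} (ha : π a = π a')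
    (hb : π b = π b') : ⁅a, b⁆ = ⁅a', b'⁆ := by
  have h₁ := hπ.lie_eq_zero (a := a - a') (by rw [map_sub, ha, sub_self]) b
  have h₂ := hπ.lie_eq_zero' (a := b - b') (by rw [map_sub, hb, sub_self]) a'
  rw [sub_lie, sub_eq_zero] at h₁
  rw [lie_sub, sub_eq_zero] at h₂
  rw [h₁, h₂]

end IsCentralExtension

/-! ### Even triples -/

/-- The vertex `k` such that `(i, j, k)` is even, for distinct `i, j`. -/
def thirdVertex (i j : Fin 4) : Fin 4 :=
  ![![0, 2, 3, 1], ![3, 1, 0, 2], ![1, 3, 2, 0], ![2, 0, 1, 3]] i j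

theorem EvenTriple.thirdVertex_eq {i j k : Fin 4} (h : EvenTriple i j k) :
    thirdVertex i j = k := by
  obtain ⟨τ, hτ, rfl, rfl, rfl⟩ := h
  rw [Equiv.Perm.mem_alternatingGroup] at hτ
  revert τ
  decide

theorem evenTriple_thirdVertex {i j : Fin 4} (h : i ≠ j) : EvenTriple i j (thirdVertex i j) := by
  have : ∀ i j : Fin 4, i ≠ j → ∃ τ : Equiv.Perm (Fin 4), Equiv.Perm.sign τ = 1 ∧
      τ 0 = i ∧ τ 1 = j ∧ τ 2 = thirdVertex i j := by decide
  exact this i j h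

theorem thirdVertex_distinct : ∀ i j : Fin 4, i ≠ j →
    thirdVertex j (thirdVertex i j) = i ∧ thirdVertex (thirdVertex i j) i = j ∧
      thirdVertex i j ≠ i ∧ j ≠ thirdVertex i j := by
  decide

theorem evenTriple_or_reverse {i j k : Fin 4} (hij : i ≠ j) (hjk : j ≠ k) (hik : i ≠ k) :
    EvenTriple i j k ∨ EvenTriple k j i := by
  have h : ∀ i j k : Fin 4, i ≠ j → j ≠ k → i ≠ k →
      thirdVertex i j = k ∨ thirdVertex k j = i := by decide
  rcases h i j k hij hjk hik with h | h
  · exact Or.inl (h ▸ evenTriple_thirdVertex hij)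
  · exact Or.inr (h ▸ evenTriple_thirdVertex hjk.symm)

/-! ### Partitions into pairs -/

namespace PairPartition

/-- A part other than `s` lies in `sᶜ`, which also has two elements, hence equals it; such a part
exists because `sᶜ` must be covered. -/
theorem parts_eq (p : PairPartition) {s : Finset (Fin 4)} (hs : s ∈ p.toFinpartition.parts) :
    p.toFinpartition.parts = {s, sᶜ} := by
  have hsub : ∀ t ∈ p.toFinpartition.parts, t = s ∨ t = sᶜ := by
    intro t ht
    by_cases hts : t = s
    · exact Or.inl hts
    · right
      have hd : Disjoint t s := p.toFinpartition.disjoint ht hs hts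
      refine Finset.eq_of_subset_of_card_le
        (fun a ha => Finset.mem_compl.2 (Finset.disjoint_left.1 hd ha)) ?_
      rw [Finset.card_compl, p.card_eq_two s hs, p.card_eq_two t ht]
      rfl
  obtain ⟨a, ha⟩ : ∃ a, a ∈ sᶜ := by
    rw [← Finset.Nonempty, ← Finset.card_pos, Finset.card_compl, p.card_eq_two s hs]
    decide
  obtain ⟨t, ht, hat⟩ := p.toFinpartition.exists_mem (Finset.mem_univ a)
  have hts : t = sᶜ := by
    rcases hsub t ht with rfl | h
    · exact absurd hat (Finset.mem_compl.1 ha)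
    · exact h
  ext u
  rw [Finset.mem_insert, Finset.mem_singleton]
  refine ⟨hsub u, ?_⟩
  rintro (rfl | rfl)
  · exact hs
  · exact hts ▸ ht

theorem eq_of_mem {p q : PairPartition} {s : Finset (Fin 4)} (hp : s ∈ p.toFinpartition.parts)
    (hq : s ∈ q.toFinpartition.parts) : p = q :=
  PairPartition.ext (Finpartition.ext ((p.parts_eq hp).trans (q.parts_eq hq).symm))

/-- The partition in which `0` is matched with `a + 1`. -/
def ofFin (a : Fin 3) : PairPartition where
  toFinpartition :=
    { parts := {{0, a.succ}, {0, a.succ}ᶜ}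
      supIndep := by
        rw [Finset.supIndep_iff_pairwiseDisjoint]
        intro s hs t ht hst
        simp only [Finset.coe_insert, Finset.coe_singleton, Set.mem_insert_iff,
          Set.mem_singleton_iff] at hs ht
        rcases hs with rfl | rfl <;> rcases ht with rfl | rfl
        · exact absurd rfl hst
        · exact disjoint_compl_right
        · exact disjoint_compl_left
        · exact absurd rfl hst
      sup_parts := by revert a; decide
      bot_notMem := by revert a; decide }
  card_eq_two := by revert a; decide

theorem mem_ofFin (a : Fin 3) : {0, a.succ} ∈ (ofFin a).toFinpartition.parts := by
  simp [ofFin]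

theorem exists_mem_zero (p : PairPartition) :
    ∃ a : Fin 3, {0, a.succ} ∈ p.toFinpartition.parts := by
  obtain ⟨s, hs, h0⟩ := p.toFinpartition.exists_mem (Finset.mem_univ 0)
  have h : ∀ s : Finset (Fin 4), s.card = 2 → 0 ∈ s → ∃ a : Fin 3, s = {0, a.succ} := by decide
  obtain ⟨a, rfl⟩ := h s (p.card_eq_two s hs) h0
  exact ⟨a, hs⟩

theorem bijective_ofFin : Function.Bijective ofFin := by
  constructor
  · intro a b hab
    have h := mem_ofFin a
    rw [hab, (ofFin b).parts_eq (mem_ofFin b)] at h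
    have key : ∀ a b : Fin 3, ({0, a.succ} : Finset (Fin 4)) ∈
        ({{0, b.succ}, {0, b.succ}ᶜ} : Finset (Finset (Fin 4))) → a = b := by decide
    exact key a b h
  · intro p
    obtain ⟨a, ha⟩ := p.exists_mem_zero
    exact ⟨a, eq_of_mem (mem_ofFin a) ha⟩

theorem exists_mem (p : PairPartition) :
    ∃ i j : Fin 4, i ≠ j ∧ {i, j} ∈ p.toFinpartition.parts :=
  let ⟨a, ha⟩ := p.exists_mem_zero
  ⟨0, a.succ, (Fin.succ_ne_zero a).symm, ha⟩

end PairPartition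

/-! ### Relations in `⊠` and `⊠̂` -/

namespace Tetrahedron

variable (F : Type*) [Field F]

theorem lift_x_eq_zero {r : FreeLieAlgebra F TetGen} (hr : TetRel F r) :
    FreeLieAlgebra.lift F (PresentedLieAlgebra.of F {r | TetRel F r}) r = 0 := by
  rw [PresentedLieAlgebra.lift_of_eq_mk]
  exact PresentedLieAlgebra.mk_eq_zero_of_mem hr

theorem x_add_x {i j : Fin 4} (h : i ≠ j) : x F i j h + x F j i h.symm = 0 := by
  simpa [x] using lift_x_eq_zero F (TetRel.skew i j h)

theorem lie_x_x {i j k : Fin 4} (hij : i ≠ j) (hjk : j ≠ k) (hik : i ≠ k) :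
    ⁅x F i j hij, x F j k hjk⁆ = (2 : F) • x F i j hij + (2 : F) • x F j k hjk := by
  simpa [x, sub_eq_zero] using lift_x_eq_zero F (TetRel.triple i j k hij hjk hik)

theorem dolanGrady {i j k l : Fin 4} (hij : i ≠ j) (hik : i ≠ k) (hil : i ≠ l) (hjk : j ≠ k)
    (hjl : j ≠ l) (hkl : k ≠ l) :
    ⁅x F i j hij, ⁅x F i j hij, ⁅x F i j hij, x F k l hkl⁆⁆⁆ =
      (4 : F) • ⁅x F i j hij, x F k l hkl⁆ := by
  simpa [x, sub_eq_zero] using lift_x_eq_zero F (TetRel.dolanGrady i j k l hij hik hil hjk hjl hkl)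

/-- The generator `x_{i,j}` extended by `x_{i,i} = 0`. -/
noncomputable def edge (i j : Fin 4) : Tetrahedron F :=
  if h : i ≠ j then x F i j h else 0

theorem edge_of_ne {i j : Fin 4} (h : i ≠ j) : edge F i j = x F i j h :=
  dif_pos h

theorem edge_self (i : Fin 4) : edge F i i = 0 :=
  dif_neg (not_not.2 rfl)

theorem edge_swap (i j : Fin 4) : edge F j i = -edge F i j := by
  by_cases h : i = j
  · subst h
    simp [edge_self]
  · rw [edge_of_ne F h, edge_of_ne F (Ne.symm h), eq_neg_iff_add_eq_zero, add_comm, x_add_x]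

theorem lie_edge_edge {i j k : Fin 4} (hij : i ≠ j) (hjk : j ≠ k) (hik : i ≠ k) :
    ⁅edge F i j, edge F j k⁆ = (2 : F) • edge F i j + (2 : F) • edge F j k := by
  rw [edge_of_ne F hij, edge_of_ne F hjk, lie_x_x F hij hjk hik]

theorem lie_add_swap {F : Type*} [Field F] {K : Type*} [LieRing K] [LieAlgebra F K] {π : K →ₗ⁅F⁆ Tetrahedron F}
    (hπ : IsCentralExtension π) {z : Fin 4 → Fin 4 → K}
    (hz : ∀ i j, π (z i j) = edge F i j) (i j : Fin 4) (a : K) : ⁅a, z i j + z j i⁆ = 0 := by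
  refine hπ.lie_eq_zero' ?_ a
  rw [map_add, hz, hz, edge_swap, neg_add_cancel]

end Tetrahedron

namespace HatTetrahedron

variable (F : Type*) [Field F]

theorem lift_of_eq_zero {r : FreeLieAlgebra F HatTetGen} (hr : HatTetRel F r) :
    FreeLieAlgebra.lift F (PresentedLieAlgebra.of F {r | HatTetRel F r}) r = 0 := by
  rw [PresentedLieAlgebra.lift_of_eq_mk]
  exact PresentedLieAlgebra.mk_eq_zero_of_mem hr

theorem lie_C (p : PairPartition) (a : HatTetrahedron F) : ⁅C F p, a⁆ = 0 := by
  obtain ⟨a, rfl⟩ := PresentedLieAlgebra.surjective_mk a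
  have h := lift_of_eq_zero F (HatTetRel.central p a)
  rwa [LieHom.map_lie, FreeLieAlgebra.lift_of_apply, PresentedLieAlgebra.lift_of_eq_mk] at h

theorem C_mem_center (p : PairPartition) : C F p ∈ LieAlgebra.center F (HatTetrahedron F) :=
  (LieModule.mem_maxTrivSubmodule F _ _ _).2 fun a => by rw [← lie_skew, lie_C, neg_zero]

theorem X_add_X {i j : Fin 4} (h : i ≠ j) {p : PairPartition}
    (hp : {i, j} ∈ p.toFinpartition.parts) : X F i j h + X F j i h.symm = C F p := by
  simpa [X, C, sub_eq_zero] using lift_of_eq_zero F (HatTetRel.skew i j h p hp)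

theorem lie_X_X {i j k : Fin 4} (hij : i ≠ j) (hjk : j ≠ k) (hik : i ≠ k)
    (he : EvenTriple i j k) :
    ⁅X F i j hij, X F j k hjk⁆ = (2 : F) • X F i j hij + (2 : F) • X F j k hjk := by
  simpa [X, sub_eq_zero] using lift_of_eq_zero F (HatTetRel.triple i j k hij hjk hik he)

theorem dolanGrady {i j k l : Fin 4} (hij : i ≠ j) (hik : i ≠ k) (hil : i ≠ l) (hjk : j ≠ k)
    (hjl : j ≠ l) (hkl : k ≠ l) :
    ⁅X F i j hij, ⁅X F i j hij, ⁅X F i j hij, X F k l hkl⁆⁆⁆ =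
      (4 : F) • ⁅X F i j hij, X F k l hkl⁆ := by
  simpa [X, sub_eq_zero] using
    lift_of_eq_zero F (HatTetRel.dolanGrady i j k l hij hik hil hjk hjl hkl)

theorem surjective_proj : Function.Surjective (proj F) := by
  intro a
  refine (LieHom.mem_range (proj F) a).1
    (PresentedLieAlgebra.mem_of_forall_of_mem (proj F).range ?_ a)
  rintro ⟨i, j, h⟩
  exact ⟨X F i j h, proj_X F i j h⟩

theorem exists_pairPartition {i j : Fin 4} (h : i ≠ j) :
    ∃ p : PairPartition, {i, j} ∈ p.toFinpartition.parts := by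
  have : ∀ i j : Fin 4, i ≠ j →
      ∃ a : Fin 3, {i, j} ∈ (PairPartition.ofFin a).toFinpartition.parts := by decide
  obtain ⟨a, ha⟩ := this i j h
  exact ⟨_, ha⟩

/-- The quotient map of `⊠̂` by its center. -/
noncomputable def modCenter :
    HatTetrahedron F →ₗ⁅F⁆ HatTetrahedron F ⧸ LieAlgebra.center F (HatTetrahedron F) :=
  { (LieSubmodule.Quotient.mk' (LieAlgebra.center F (HatTetrahedron F)) :
      HatTetrahedron F →ₗ[F] _) with
    map_lie' := fun {x y} => LieSubmodule.Quotient.mk_bracket _ x y }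

theorem modCenter_eq_zero {a : HatTetrahedron F} :
    modCenter F a = 0 ↔ a ∈ LieAlgebra.center F (HatTetrahedron F) :=
  LieSubmodule.Quotient.mk_eq_zero'

theorem modCenter_swap {i j : Fin 4} (h : i ≠ j) :
    modCenter F (X F j i h.symm) = -modCenter F (X F i j h) := by
  obtain ⟨p, hp⟩ := exists_pairPartition h
  rw [eq_neg_iff_add_eq_zero, add_comm, ← map_add, X_add_X F h hp]
  exact (modCenter_eq_zero F).2 (C_mem_center F p)

/-- The images in `⊠̂` modulo its center of the generators of `⊠`. -/
noncomputable def modCenterGen :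
    TetGen → HatTetrahedron F ⧸ LieAlgebra.center F (HatTetrahedron F)
  | TetGen.x i j h => modCenter F (X F i j h)

theorem lift_modCenterGen_eq_zero (r : FreeLieAlgebra F TetGen) (hr : TetRel F r) :
    FreeLieAlgebra.lift F (modCenterGen F) r = 0 := by
  cases hr with
  | skew i j hij => simp [modCenterGen, modCenter_swap F hij]
  | triple i j k hij hjk hik =>
    simp only [map_sub, map_add, map_smul, LieHom.map_lie, FreeLieAlgebra.lift_of_apply,
      modCenterGen]
    rcases evenTriple_or_reverse hij hjk hik with he | he
    · rw [← LieHom.map_lie, lie_X_X F hij hjk hik he]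
      simp
    -- For an odd triple, use the relation for the reversed, even triple and flip signs, which is
    -- legitimate modulo the center.
    · have h := congrArg (modCenter F) (lie_X_X F hjk.symm hij.symm hik.symm he)
      rw [LieHom.map_lie, map_add, map_smul, map_smul, modCenter_swap F hij,
        modCenter_swap F hjk, lie_neg, neg_lie, neg_neg, ← lie_skew, neg_eq_iff_eq_neg] at h
      rw [h]
      module
  | dolanGrady i j k l hij hik hil hjk hjl hkl =>
    simp only [map_sub, map_smul, LieHom.map_lie, FreeLieAlgebra.lift_of_apply, modCenterGen]
    simp only [← LieHom.map_lie]
    rw [dolanGrady F hij hik hil hjk hjl hkl, map_smul, sub_self]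

/-- The quotient map by the center factors as `⊠̂ → ⊠ → ⊠̂ / Z`, so it kills whatever `proj` kills.
-/
theorem ker_proj_le : (proj F).ker ≤ LieAlgebra.center F (HatTetrahedron F) := by
  intro a ha
  have h : (PresentedLieAlgebra.lift (modCenterGen F) (lift_modCenterGen_eq_zero F)).comp (proj F) =
      modCenter F := by
    refine PresentedLieAlgebra.hom_ext ?_
    rintro (⟨i, j, h⟩ | p)
    · exact (congrArg _ (proj_X F i j h)).trans
        (PresentedLieAlgebra.lift_of _ (lift_modCenterGen_eq_zero F) (TetGen.x i j h))
    · exact ((congrArg _ (proj_C F p)).trans (map_zero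
        (PresentedLieAlgebra.lift (modCenterGen F) (lift_modCenterGen_eq_zero F)))).trans
        ((modCenter_eq_zero F).2 (C_mem_center F p)).symm
  rw [← modCenter_eq_zero, ← h, LieHom.comp_apply, (LieHom.mem_ker).1 ha, map_zero]

theorem isCentralExtension_proj : IsCentralExtension (proj F) :=
  ⟨surjective_proj F, ker_proj_le F⟩

end HatTetrahedron

/-! ### Uniqueness -/

namespace HatTetrahedron

/-- The triple relations around a cyclic even triangle give the pairwise sums of its three edges;
solving for one edge gives perfectness of `⊠̂`. -/
theorem X_eq_lie (F : Type*) [Field F] [CharZero F] {i j k : Fin 4} (hij : i ≠ j) (hjk : j ≠ k)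
    (hki : k ≠ i) (h₁ : EvenTriple i j k) (h₂ : EvenTriple j k i) (h₃ : EvenTriple k i j) :
    X F i j hij = (1 / 4 : F) • (⁅X F i j hij, X F j k hjk⁆ + ⁅X F k i hki, X F i j hij⁆ -
      ⁅X F j k hjk, X F k i hki⁆) := by
  rw [lie_X_X F hij hjk hki.symm h₁, lie_X_X F hki hij hjk.symm h₃,
    lie_X_X F hjk hki hij.symm h₂]
  module

theorem hom_eq_of_comp_eq {F : Type*} [Field F] [CharZero F] {K L : Type*} [LieRing K]
    [LieAlgebra F K] [LieRing L] [LieAlgebra F L] {π' : K →ₗ⁅F⁆ L} (hπ' : IsCentralExtension π')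
    {φ ψ : HatTetrahedron F →ₗ⁅F⁆ K} (h : π'.comp φ = π'.comp ψ) : φ = ψ := by
  have hlie : ∀ a b : HatTetrahedron F, φ ⁅a, b⁆ = ψ ⁅a, b⁆ := fun a b => by
    rw [LieHom.map_lie, LieHom.map_lie]
    exact hπ'.lie_congr (LieHom.congr_fun h a) (LieHom.congr_fun h b)
  have hX : ∀ (i j : Fin 4) (hij : i ≠ j), φ (X F i j hij) = ψ (X F i j hij) := by
    intro i j hij
    obtain ⟨h₁, h₂, h₃, h₄⟩ := thirdVertex_distinct i j hij
    have e₁ := evenTriple_thirdVertex h₄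
    have e₂ := evenTriple_thirdVertex h₃
    rw [h₁] at e₁
    rw [h₂] at e₂
    rw [X_eq_lie F hij h₄ h₃ (evenTriple_thirdVertex hij) e₁ e₂]
    simp only [map_smul, map_sub, map_add, hlie]
  refine PresentedLieAlgebra.hom_ext ?_
  rintro (⟨i, j, hij⟩ | p)
  · exact hX i j hij
  · obtain ⟨i, j, hij, hp⟩ := p.exists_mem
    change φ (C F p) = ψ (C F p)
    rw [← X_add_X F hij hp, map_add, map_add, hX, hX]

end HatTetrahedron

/-! ### Existence -/

section Exists

variable {F : Type*} [Field F] [CharZero F] {K : Type*} [LieRing K] [LieAlgebra F K]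

/-- The Dolan–Grady relation from the weights of `ad h`. -/
theorem dolanGrady_of_weights {h z e e' ζ : K} (he : ⁅h, e⁆ = (2 : F) • e)
    (he' : ⁅h, e'⁆ = (2 : F) • e') (hζ : ⁅h, ⁅h, ⁅h, z⁆⁆⁆ - (4 : F) • ⁅h, z⁆ = ζ)
    (hζh : ⁅h, ζ⁆ = 0) (hζe : ⁅e, ζ⁆ = 0) (hζe' : ⁅e', ζ⁆ = 0)
    (hz : ⁅h, (4 : F) • z - (⁅e + e', z⁆ - (2 : F) • ⁅h, z⁆ + ⁅e', e⁆ - (2 : F) • e +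
      (2 : F) • e')⁆ = 0) : ζ = 0 := by
  -- With `D = ad h`, an element `f` of weight 2 satisfies `D ∘ ad f = ad f ∘ (D + 2)`.
  have hD : ∀ f a : K, ⁅h, f⁆ = (2 : F) • f → ⁅h, ⁅f, a⁆⁆ = (2 : F) • ⁅f, a⁆ + ⁅f, ⁅h, a⁆⁆ := by
    intro f a hf
    rw [leibniz_lie, hf, smul_lie]
  have hE : ⁅h, e + e'⁆ = (2 : F) • (e + e') := by rw [lie_add, he, he', smul_add]
  have hζE : ⁅e + e', ζ⁆ = 0 := by rw [add_lie, hζe, hζe', add_zero]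
  have hee : ⁅h, ⁅e', e⁆⁆ = (4 : F) • ⁅e', e⁆ := by
    rw [hD _ _ he', he, lie_smul]
    module
  have h3 : ⁅h, ⁅h, ⁅h, z⁆⁆⁆ = (4 : F) • ⁅h, z⁆ + ζ := by rw [← hζ]; module
  have e0 := hD _ z hE
  have e1 := hD _ ⁅h, z⁆ hE
  have e2 := hD _ ⁅h, ⁅h, z⁆⁆ hE
  rw [h3, lie_add, hζE, lie_smul, add_zero] at e2
  generalize e + e' = E at *
  have k1 := hz
  simp only [lie_sub, lie_add, lie_smul, he, he', hee, e0] at k1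
  have k2 := congrArg (fun a => ⁅h, a⁆) k1
  simp only [lie_sub, lie_add, lie_smul, he, he', hee, e0, e1, h3, lie_zero] at k2
  have k3 := congrArg (fun a => ⁅h, a⁆) k2
  simp only [lie_sub, lie_add, lie_smul, he, he', hee, e0, e1, e2, h3, hζh, lie_zero] at k3
  have k4 := congrArg (fun a => ⁅h, a⁆) k3
  simp only [lie_sub, lie_add, lie_smul, he, he', hee, e0, e1, e2, h3, hζh, lie_zero] at k4
  -- This applies `-D(D-2)(D+2)(D-4)` to the element in `hz`. The factor `D-2` kills `e`, `e'` and
  -- `D-4` kills `⁅e', e⁆`. On `⁅E, z⁆` the polynomial becomes `-ad E` applied to `(D+4)ζ = 4ζ`,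
  -- which is zero. Since `D(D-2)(D+2)z = ζ` and `Dζ = 0`, only the `4z` term contributes, giving
  -- `16ζ`.
  have k : (16 : F) • ζ = 0 := by
    linear_combination (norm := module) (4 : F) • k3 + (4 : F) • k2 - k4 - (16 : F) • k1
  exact (smul_eq_zero.1 k).resolve_left (by norm_num)

/-- The Jacobi identity for three elements whose brackets are of equitable type. -/
theorem add_eq_zero_of_lie_eq {p q r a b c : K} (ha : ∀ y : K, ⁅y, a⁆ = 0) (hb : ∀ y : K, ⁅y, b⁆ = 0)
    (hc : ∀ y : K, ⁅y, c⁆ = 0) (hpq : ⁅p, q⁆ = (2 : F) • (p - q - a))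
    (hqr : ⁅q, r⁆ = (2 : F) • (q - r - b)) (hrp : ⁅r, p⁆ = (2 : F) • (r - p - c)) :
    a + b + c = 0 := by
  have hqp : ⁅q, p⁆ = (-2 : F) • (p - q - a) := by rw [← lie_skew, hpq]; module
  have hrq : ⁅r, q⁆ = (-2 : F) • (q - r - b) := by rw [← lie_skew, hqr]; module
  have hpr : ⁅p, r⁆ = (-2 : F) • (r - p - c) := by rw [← lie_skew, hrp]; module
  -- Each of the three brackets enters the expansion twice; `p`, `q`, `r` cancel cyclically and
  -- `-8(a + b + c)` remains.
  have h := lie_jacobi p q r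
  simp only [hqr, hrp, hpq, hqp, hrq, hpr, lie_smul, lie_sub, ha, hb, hc] at h
  have k : (8 : F) • (a + b + c) = 0 := by
    linear_combination (norm := module) -h
  exact (smul_eq_zero.1 k).resolve_left (by norm_num)

namespace Tetrahedron

variable {π : K →ₗ⁅F⁆ Tetrahedron F}

/-- A lift to a central extension of the generators of `⊠`, normalized on the even triples. -/
theorem exists_normalized_lift (hπ : IsCentralExtension π) :
    ∃ z : Fin 4 → Fin 4 → K, (∀ i j, π (z i j) = edge F i j) ∧
      ∀ i j k, i ≠ j → EvenTriple i j k →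
        ⁅z i j, z j k⁆ = (2 : F) • z i j + (2 : F) • z j k := by
  choose y hy using fun i j => hπ.1 (edge F i j)
  let w : Fin 4 → Fin 4 → Fin 4 → K := fun i j k =>
    (1 / 4 : F) • (⁅y i j, y j k⁆ + ⁅y k i, y i j⁆ - ⁅y j k, y k i⁆)
  have hw : ∀ i j, π (w i j (thirdVertex i j)) = edge F i j := by
    intro i j
    by_cases hij : i = j
    · subst hij
      have h : ∀ i, thirdVertex i i = i := by decide
      simp [w, edge_self, h]
    · obtain ⟨-, -, h₃, h₄⟩ := thirdVertex_distinct i j hij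
      simp only [w, map_smul, map_add, map_sub, LieHom.map_lie, hy]
      rw [lie_edge_edge F hij h₄ h₃.symm, lie_edge_edge F h₃ hij h₄.symm,
        lie_edge_edge F h₄ h₃ (Ne.symm hij)]
      module
  refine ⟨fun i j => w i j (thirdVertex i j), hw, fun i j k hij he => ?_⟩
  obtain ⟨h₁, -, -, -⟩ := thirdVertex_distinct i j hij
  rw [hπ.lie_congr ((hw i j).trans (hy i j).symm) ((hw j k).trans (hy j k).symm)]
  rw [he.thirdVertex_eq] at h₁
  simp only [h₁, he.thirdVertex_eq, w]
  module

variable {z : Fin 4 → Fin 4 → K}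

theorem sum_star_eq_zero (hπ : IsCentralExtension π) (hz : ∀ i j, π (z i j) = edge F i j)
    (hlie : ∀ i j k, i ≠ j → EvenTriple i j k →
      ⁅z i j, z j k⁆ = (2 : F) • z i j + (2 : F) • z j k)
    {v a b c : Fin 4} (hav : a ≠ v) (hbv : b ≠ v) (hcv : c ≠ v) (hab : EvenTriple a v b)
    (hbc : EvenTriple b v c) (hca : EvenTriple c v a) :
    (z v a + z a v) + (z v b + z b v) + (z v c + z c v) = 0 := by
  have key : ∀ p q, p ≠ v → EvenTriple p v q →
      ⁅z v p, z v q⁆ = (2 : F) • (z v p - z v q - (z v p + z p v)) := by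
    intro p q hpv he
    have h := lie_add_swap hπ hz p v (z v q)
    rw [← lie_skew, neg_eq_zero, add_lie, hlie p v q hpv he] at h
    linear_combination (norm := module) h
  exact add_eq_zero_of_lie_eq (F := F) (lie_add_swap hπ hz v a) (lie_add_swap hπ hz v b)
    (lie_add_swap hπ hz v c) (key a b hav hab) (key b c hbv hbc) (key c a hcv hca)

theorem dolanGrady_lift (hπ : IsCentralExtension π) (hz : ∀ i j, π (z i j) = edge F i j)
    {i j k l : Fin 4} (hij : i ≠ j) (hik : i ≠ k) (hil : i ≠ l) (hjk : j ≠ k)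
    (hjl : j ≠ l) (hkl : k ≠ l) :
    ⁅z i j, ⁅z i j, ⁅z i j, z k l⁆⁆⁆ = (4 : F) • ⁅z i j, z k l⁆ := by
  rw [← sub_eq_zero]
  have hζ : π (⁅z i j, ⁅z i j, ⁅z i j, z k l⁆⁆⁆ - (4 : F) • ⁅z i j, z k l⁆) = 0 := by
    simp only [map_sub, map_smul, LieHom.map_lie, hz]
    rw [edge_of_ne F hij, edge_of_ne F hkl, dolanGrady F hij hik hil hjk hjl hkl, sub_self]
  have hw : ∀ m, j ≠ m → i ≠ m → ⁅z i j, (1 / 2 : F) • ⁅z i j, z j m⁆⁆ =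
      (2 : F) • (1 / 2 : F) • ⁅z i j, z j m⁆ := by
    intro m hjm him
    have h : ⁅z i j, ⁅z i j, z j m⁆⁆ = ⁅z i j, (2 : F) • z i j + (2 : F) • z j m⁆ := by
      refine hπ.lie_congr rfl ?_
      simp only [map_add, map_smul, LieHom.map_lie, hz]
      exact lie_edge_edge F hij hjm him
    rw [lie_smul, h, lie_add, lie_smul, lie_smul, lie_self]
    module
  refine dolanGrady_of_weights (F := F) (hw k hjk hik) (hw l hjl hil) rfl
    (hπ.lie_eq_zero' hζ _) (hπ.lie_eq_zero' hζ _) (hπ.lie_eq_zero' hζ _)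
    (hπ.lie_eq_zero' ?_ _)
  have hlk : ⁅edge F j l, edge F k l⁆ = (2 : F) • edge F k l - (2 : F) • edge F j l := by
    rw [edge_swap F l k, lie_neg, lie_edge_edge F hjl hkl.symm hjk, edge_swap F k l]
    module
  have hjj : ⁅edge F j l, edge F j k⁆ = (2 : F) • edge F j l - (2 : F) • edge F j k := by
    rw [edge_swap F l j, neg_lie, lie_edge_edge F hjl.symm hjk hkl.symm, edge_swap F j l]
    module
  have hil' : ⁅edge F j l, edge F i j⁆ = -((2 : F) • edge F i j + (2 : F) • edge F j l) := by
    rw [← lie_skew, lie_edge_edge F hij hjl hil]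
  simp only [map_add, map_sub, map_smul, LieHom.map_lie, hz, lie_edge_edge F hij hjk hik,
    lie_edge_edge F hij hjl hil, lie_edge_edge F hjk hkl hjl, hlk, hjj, hil', add_lie, lie_add,
    smul_lie, lie_smul, lie_self]
  module

end Tetrahedron

namespace HatTetrahedron

/-- The images of the generators of `⊠̂` determined by a lift of the generators of `⊠`. -/
noncomputable def liftGen (z : Fin 4 → Fin 4 → K) : HatTetGen → K
  | HatTetGen.X i j _ => z i j
  | HatTetGen.C p => z 0 p.exists_mem_zero.choose.succ + z p.exists_mem_zero.choose.succ 0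

theorem exists_hom {π : K →ₗ⁅F⁆ Tetrahedron F} (hπ : IsCentralExtension π) :
    ∃ φ : HatTetrahedron F →ₗ⁅F⁆ K, π.comp φ = proj F := by
  obtain ⟨z, hz, hlie⟩ := Tetrahedron.exists_normalized_lift hπ
  have star : ∀ v a : Fin 4, a ≠ v → (z v a + z a v) +
      (z v (thirdVertex a v) + z (thirdVertex a v) v) +
      (z v (thirdVertex (thirdVertex a v) v) + z (thirdVertex (thirdVertex a v) v) v) = 0 := by
    intro v a hav
    have hd : ∀ v a : Fin 4, a ≠ v → thirdVertex a v ≠ v ∧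
        thirdVertex (thirdVertex a v) v ≠ v ∧
        thirdVertex (thirdVertex (thirdVertex a v) v) v = a := by decide
    obtain ⟨hb, hc, hca⟩ := hd v a hav
    refine Tetrahedron.sum_star_eq_zero hπ hz hlie hav hb hc (evenTriple_thirdVertex hav)
      (evenTriple_thirdVertex hb) ?_
    have := evenTriple_thirdVertex hc
    rwa [hca] at this
  have s0 : (z 0 1 + z 1 0) + (z 0 3 + z 3 0) + (z 0 2 + z 2 0) = 0 := star 0 1 (by decide)
  have s1 : (z 1 0 + z 0 1) + (z 1 2 + z 2 1) + (z 1 3 + z 3 1) = 0 := star 1 0 (by decide)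
  have s2 : (z 2 0 + z 0 2) + (z 2 3 + z 3 2) + (z 2 1 + z 1 2) = 0 := star 2 0 (by decide)
  have s3 : (z 3 0 + z 0 3) + (z 3 1 + z 1 3) + (z 3 2 + z 2 3) = 0 := star 3 0 (by decide)
  have t1 : z 2 3 + z 3 2 = z 0 1 + z 1 0 := by
    linear_combination (norm := module) (1 / 2 : F) • (s2 + s3 - s0 - s1)
  have t2 : z 1 3 + z 3 1 = z 0 2 + z 2 0 := by
    linear_combination (norm := module) (1 / 2 : F) • (s1 + s3 - s0 - s2)
  have t3 : z 1 2 + z 2 1 = z 0 3 + z 3 0 := by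
    linear_combination (norm := module) (1 / 2 : F) • (s1 + s2 - s0 - s3)
  have skew : ∀ (i j : Fin 4), i ≠ j → ∀ p : PairPartition, {i, j} ∈ p.toFinpartition.parts →
      z i j + z j i = liftGen z (HatTetGen.C p) := by
    intro i j hij p hp
    have hm := p.exists_mem_zero.choose_spec
    simp only [liftGen]
    generalize p.exists_mem_zero.choose = a at hm ⊢
    rw [p.parts_eq hm] at hp
    revert hp
    fin_cases a <;> fin_cases i <;> fin_cases j <;>
      first
        | exact fun hp => absurd hp (by decide)
        | (intro; first | rfl | exact add_comm _ _ | exact t1 | exact t2 | exact t3 |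
            exact (add_comm _ _).trans t1 | exact (add_comm _ _).trans t2 |
            exact (add_comm _ _).trans t3)
  have hrel : ∀ r ∈ {r | HatTetRel F r}, FreeLieAlgebra.lift F (liftGen z) r = 0 := by
    rintro r (⟨p, a⟩ | _ | ⟨i, j, hij, p, hp⟩ | ⟨i, j, k, hij, hjk, hik, he⟩ |
      ⟨i, j, k, l, hij, hik, hil, hjk, hjl, hkl⟩)
    · rw [LieHom.map_lie, FreeLieAlgebra.lift_of_apply, ← lie_skew, neg_eq_zero]
      exact Tetrahedron.lie_add_swap hπ hz _ _ _
    · simp only [map_sum, FreeLieAlgebra.lift_of_apply]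
      rw [← PairPartition.bijective_ofFin.sum_comp, Fin.sum_univ_three]
      rw [← skew 0 _ (Fin.succ_ne_zero 0).symm _ (PairPartition.mem_ofFin 0),
        ← skew 0 _ (Fin.succ_ne_zero 1).symm _ (PairPartition.mem_ofFin 1),
        ← skew 0 _ (Fin.succ_ne_zero 2).symm _ (PairPartition.mem_ofFin 2)]
      rw [← s0]
      exact add_right_comm _ _ _
    · simp only [map_sub, map_add, FreeLieAlgebra.lift_of_apply]
      rw [← skew i j hij p hp]
      exact sub_self _
    · simp only [map_sub, map_add, map_smul, LieHom.map_lie, FreeLieAlgebra.lift_of_apply]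
      exact sub_eq_zero.2 (hlie i j k hij he)
    · simp only [map_sub, map_smul, LieHom.map_lie, FreeLieAlgebra.lift_of_apply]
      exact sub_eq_zero.2 (Tetrahedron.dolanGrady_lift hπ hz hij hik hil hjk hjl hkl)
  refine ⟨PresentedLieAlgebra.lift (liftGen z) hrel, PresentedLieAlgebra.hom_ext ?_⟩
  rintro (⟨i, j, hij⟩ | p)
  · rw [LieHom.comp_apply, PresentedLieAlgebra.lift_of]
    exact ((hz i j).trans (Tetrahedron.edge_of_ne F hij)).trans (proj_X F i j hij).symm
  · rw [LieHom.comp_apply, PresentedLieAlgebra.lift_of]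
    refine Eq.trans ?_ (proj_C F p).symm
    simp only [liftGen]
    rw [map_add, hz, hz, Tetrahedron.edge_swap, neg_add_cancel]

end HatTetrahedron

end Exists

theorem corollary5p4 (F : Type u) [Field F] [CharZero F] :
    IsUniversalCentralExtension.{v} (HatTetrahedron.proj F) := by
  refine ⟨HatTetrahedron.isCentralExtension_proj F, fun K' _ _ π' hπ' => ?_⟩
  obtain ⟨φ, hφ⟩ := HatTetrahedron.exists_hom hπ'
  exact ⟨φ, hφ, fun ψ hψ => HatTetrahedron.hom_eq_of_comp_eq hπ' (hψ.trans hφ.symm)⟩
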